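/- Let $X$ be a set whose cardinality $\lambda$ is $\aleph_0$ or a weakly compact cardinal (that is, $\lambda$ is uncountable and $\lambda\to(\lambda)^2_2$: for every colouring of the two-element subsets of a set of size $\lambda$ with two colours there is a subset of size $\lambda$ all of whose two-element subsets have the same colour). A *clone* on $X$ is a set of functions $X^n\to X$, $n\ge 1$, which contains all projections and is closed under composition; a clone is *precomplete* if it is maximal, with respect to inclusion, among the clones different from the clone of all functions $X^n\to X$, $n\ge1$. A function $H:X\times X\to X$ *depends heavily* on its first (second) coordinate if for some $a\in X$ the set $\{H(x,a):x\in X\}$ (respectively $\{H(a,y):y\in X\}$) has cardinality $\lambda$. A clone is *heavily binary* if it contains a function $H:X\times X\to X$ which depends heavily on both coordinates. The *full unary clone* is the set of all functions $(x_1,\dots,x_n)\mapsto f(x_k)$ with $f:X\to X$ and $1\le k\le n$. Then: 1. There is exactly one precomplete clone on $X$ which contains all unary functions $X\to X$ and is heavily binary. 2. There are exactly two precomplete clones on $X$ which contain the full unary clone. -/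

import Mathlib

universe u

/-- `Op X n` is the set of all functions from `X ^ (n + 1)` to `X`. Clones consist of functions of
arity at least one, so the index `n` stands for the arity `n + 1`. -/
abbrev Op (X : Type u) (n : ℕ) : Type u := (Fin (n + 1) → X) → X

/-- A clone on `X`: a set of finitary functions on `X` (of arities at least one) which contains all
projections and is closed under composition. `C.ops n` is the set of the `(n + 1)`-ary functions
in `C`. -/
@[ext]
structure Clone (X : Type u) where
  ops : ∀ n : ℕ, Set (Op X n)
  proj_mem : ∀ (n : ℕ) (k : Fin (n + 1)), (fun x : Fin (n + 1) → X => x k) ∈ ops n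
  comp_mem : ∀ (n k : ℕ) (g : Op X k) (f : Fin (k + 1) → Op X n),
    g ∈ ops k → (∀ i, f i ∈ ops n) → (fun x : Fin (n + 1) → X => g (fun i => f i x)) ∈ ops n

namespace Clone

variable {X : Type u}

/-- Clones are ordered by inclusion. -/
instance : PartialOrder (Clone X) where
  le C D := ∀ n, C.ops n ⊆ D.ops n
  le_refl _ _ := Set.Subset.rfl
  le_trans _ _ _ h₁ h₂ n := (h₁ n).trans (h₂ n)
  le_antisymm _ _ h₁ h₂ := Clone.ext (funext fun n => (h₁ n).antisymm (h₂ n))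

/-- The largest clone is the full clone of all finitary functions. -/
instance : OrderTop (Clone X) where
  top :=
    { ops := fun _ => Set.univ
      proj_mem := fun _ _ => Set.mem_univ _
      comp_mem := fun _ _ _ _ _ _ => Set.mem_univ _ }
  le_top _ _ := Set.subset_univ _

/-- A precomplete (or maximal) clone is a coatom of the lattice of clones. -/
def Precomplete (C : Clone X) : Prop := IsCoatom C

/-- `C` contains all unary functions. -/
def ContainsAllUnary (C : Clone X) : Prop :=
  ∀ u : X → X, (fun x : Fin 1 → X => u (x 0)) ∈ C.ops 0

/-- The full unary clone: the functions of the form `u ∘ π` with `u` unary and `π` a projection. -/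
def fullUnary (X : Type u) : Clone X where
  ops n := {f | ∃ (u : X → X) (k : Fin (n + 1)), f = fun x => u (x k)}
  proj_mem _ k := ⟨id, k, rfl⟩
  comp_mem n k g f hg hf := by
    obtain ⟨u, i, rfl⟩ := hg
    obtain ⟨v, j, hv⟩ := hf i
    exact ⟨u ∘ v, j, by simp [hv]⟩

end Clone

/-- `f` depends heavily on its `k`-th coordinate: after fixing suitable values of the other
coordinates, `f` takes `|X|` many values as the `k`-th coordinate varies over `X`. (The value `a k`
is irrelevant.) -/
def DependsHeavily {X : Type u} {n : ℕ} (f : Op X n) (k : Fin (n + 1)) : Prop :=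
  ∃ a : Fin (n + 1) → X,
    Cardinal.mk (Set.range fun x : X => f (Function.update a k x)) = Cardinal.mk X

/-- A clone is heavily binary if it contains a binary function which depends heavily on each of its
two coordinates. -/
def Clone.HeavilyBinary {X : Type u} (C : Clone X) : Prop :=
  ∃ H ∈ C.ops 1, DependsHeavily H 0 ∧ DependsHeavily H 1

/-- The partition relation `κ → (μ)ⁿ_c`, for finite `n` and `c`: whenever the `n`-element subsets of
a set `A` of cardinality `κ` are coloured with `c` colours, there is a subset `S` of `A` with at
least `μ` elements such that all `n`-element subsets of `S` have the same colour. -/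
def PartitionArrow (κ μ : Cardinal.{u}) (n c : ℕ) : Prop :=
  ∀ (A : Type u), Cardinal.mk A = κ → ∀ f : {s : Finset A // s.card = n} → Fin c,
    ∃ S : Set A, μ ≤ Cardinal.mk S ∧
      ∀ s t : {s : Finset A // s.card = n}, (s.1 : Set A) ⊆ S → (t.1 : Set A) ⊆ S → f s = f t

/-- A weakly compact cardinal: an uncountable cardinal `κ` with `κ → (κ)²₂`. -/
def IsWeaklyCompactCardinal (κ : Cardinal.{u}) : Prop :=
  Cardinal.aleph0 < κ ∧ PartitionArrow κ κ 2 2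

/-! Call a binary function heavy if it depends heavily on both arguments, and wild if, after unary
substitutions, it is injective on the increasing pairs of a well-order of `X` of type `λ`. For
either property, the functions none of whose binary minors have it form a clone, `lightClone` and
`tameClone` respectively. Closure under composition says that if `f(g₀, …, gₖ)` has the property and
no `gᵢ` has it, then some minor of `f` has it (`Heavy.exists_minor`, `Wild.exists_minor`).

The key fact (`eq_top_of_wild`) is that a clone containing all unary functions, a heavy function and
a wild one is everything. The wild function yields a separating one, which detects the order of its
arguments. This lets the heavy function be steered into an injective binary function, and that
generates all functions.

Hence a precomplete clone over the unary functions lies below `tameClone` if it has a heavy member,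
and below `lightClone` otherwise. Both are precomplete, because the light clone contains a
separating function (`upperCode`) and the tame clone a heavy one (`wedge`).

The partition property enters through `Cohesive.canonical`: along some increasing sequence, a binary
function is either unary or injective on increasing pairs. -/

open Set Cardinal

/-- A well-order in which the bounded sets are exactly the sets of fewer than `#X` elements: the
order type is an initial ordinal and `#X` is regular. -/
class RegularOrder (X : Type u) [LinearOrder X] : Prop where
  wf : WellFoundedLT X
  bddAbove_iff : ∀ s : Set X, BddAbove s ↔ #s < #X

/-! ### Eventual properties and fast-growing sequences in a regular well-order. -/

namespace RegularOrder

variable {X : Type u} [LinearOrder X] [RegularOrder X]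

/-- A set without a strict upper bound. -/
def Unbounded (s : Set X) : Prop := ∀ a, ∃ x ∈ s, a < x

omit [RegularOrder X] in
theorem not_bddAbove_iff_unbounded {s : Set X} : ¬ BddAbove s ↔ Unbounded s :=
  not_bddAbove_iff

theorem mk_eq_iff_unbounded {s : Set X} : #s = #X ↔ Unbounded s := by
  rw [← not_bddAbove_iff_unbounded, bddAbove_iff, not_lt]
  exact ⟨fun h => h.ge, fun h => le_antisymm (mk_set_le s) h⟩

theorem unbounded_univ : Unbounded (univ : Set X) :=
  mk_eq_iff_unbounded.1 mk_univ

theorem exists_gt' (a : X) : ∃ x, a < x := by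
  obtain ⟨x, -, hx⟩ := unbounded_univ a
  exact ⟨x, hx⟩

theorem BddAbove.image_of {s : Set X} (hs : BddAbove s) (f : X → X) : BddAbove (f '' s) := by
  rw [bddAbove_iff] at *
  exact mk_image_le.trans_lt hs

theorem exists_bound (f : X → X) (m : X) : ∃ b, ∀ x ≤ m, f x ≤ b := by
  obtain ⟨b, hb⟩ := BddAbove.image_of (s := Iic m) bddAbove_Iic f
  exact ⟨b, fun x hx => hb ⟨x, hx, rfl⟩⟩

/-- `P` holds eventually. -/
def Ev (P : X → Prop) : Prop := ∃ b, ∀ y, b < y → P y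

omit [RegularOrder X] in
theorem Ev.mono {P Q : X → Prop} (h : Ev P) (hPQ : ∀ y, P y → Q y) : Ev Q :=
  h.imp fun _ hb y hy => hPQ y (hb y hy)

omit [RegularOrder X] in
theorem Ev.and {P Q : X → Prop} (hP : Ev P) (hQ : Ev Q) : Ev fun y => P y ∧ Q y := by
  obtain ⟨b, hb⟩ := hP
  obtain ⟨c, hc⟩ := hQ
  exact ⟨max b c, fun y hy => ⟨hb y (lt_of_le_of_lt (le_max_left _ _) hy),
    hc y (lt_of_le_of_lt (le_max_right _ _) hy)⟩⟩

omit [RegularOrder X] in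
theorem ev_gt (a : X) : Ev fun y => a < y := ⟨a, fun _ h => h⟩

omit [RegularOrder X] in
theorem not_unbounded_iff {P : X → Prop} : ¬ Unbounded {y | P y} ↔ Ev fun y => ¬ P y := by
  simp only [Unbounded, Ev]
  push Not
  exact exists_congr fun a => ⟨fun h y hy hP => absurd (h y hP) (not_le.2 hy),
    fun h y hP => not_lt.1 fun hy => h y hy hP⟩

/-- Regularity at work: the thresholds of the `x ≤ m` are the image of a bounded set, so they have a
common bound. -/
theorem Ev.forall_le {P : X → X → Prop} (h : ∀ x, Ev (P x)) (m : X) :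
    Ev fun y => ∀ x ≤ m, P x y := by
  choose c hc using h
  obtain ⟨b, hb⟩ := exists_bound c m
  exact ⟨b, fun y hy x hx => hc x y ((hb x hx).trans_lt hy)⟩

/-- A common modulus for eventual properties with three parameters. -/
theorem exists_modulus {P : X → X → X → X → Prop} (h : ∀ x z w, Ev (P x z w)) :
    ∃ b : X → X, ∀ m x z w, x ≤ m → z ≤ m → w ≤ m → ∀ y, b m < y → P x z w y := by
  have h3 : ∀ m, Ev fun y => ∀ x ≤ m, ∀ z ≤ m, ∀ w ≤ m, P x z w y := fun m =>
    Ev.forall_le (fun x => Ev.forall_le (fun z => Ev.forall_le (fun w => h x z w) m) m) m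
  choose b hb using h3
  exact ⟨b, fun m x z w hx hz hw y hy => hb m y hy x hx z hz w hw⟩

theorem exists_seq {α : Type*} (Q : (k : X) → ((l : X) → l < k → α) → α → Prop)
    (h : ∀ k w, ∃ a, Q k w a) : ∃ s : X → α, ∀ k, Q k (fun l _ => s l) (s k) := by
  choose F hF using h
  have wf : WellFounded ((· < ·) : X → X → Prop) := (RegularOrder.wf (X := X)).wf
  refine ⟨wf.fix F, fun k => ?_⟩
  have := hF k (fun l _ => wf.fix F l)
  rwa [← wf.fix_eq F k] at this

/-- Two interleaved increasing sequences whose members grow faster than a given function. -/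
theorem exists_interleaved {E V : Set X} (hE : Unbounded E) (hV : Unbounded V) (b : X → X) :
    ∃ u v : X → X, (∀ k, u k ∈ E) ∧ (∀ k, v k ∈ V) ∧
      (∀ k, u k < v k ∧ b (u k) < v k) ∧ (∀ l k, l < k → v l < u k ∧ b (v l) < u k) := by
  obtain ⟨s, hs⟩ := exists_seq (α := X × X)
    (fun k w a => a.1 ∈ E ∧ a.2 ∈ V ∧ (a.1 < a.2 ∧ b a.1 < a.2) ∧
      ∀ l (hl : l < k), (w l hl).2 < a.1 ∧ b (w l hl).2 < a.1) (by
    intro k w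
    -- The bound is taken over `l ≤ k`; the value `k` at `l = k` is a dummy.
    obtain ⟨c, hc⟩ := exists_bound
      (fun l => if hl : l < k then max (w l hl).2 (b (w l hl).2) else k) k
    obtain ⟨x, hxE, hx⟩ := hE c
    obtain ⟨y, hyV, hy⟩ := hV (max x (b x))
    refine ⟨(x, y), hxE, hyV, max_lt_iff.1 hy, fun l hl => ?_⟩
    have := hc l hl.le
    rw [dif_pos hl] at this
    exact max_lt_iff.1 (this.trans_lt hx))
  exact ⟨fun k => (s k).1, fun k => (s k).2, fun k => (hs k).1, fun k => (hs k).2.1,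
    fun k => (hs k).2.2.1, fun l k h => (hs k).2.2.2 l h⟩

/-- An increasing sequence in an unbounded set which grows faster than a given function. -/
theorem exists_strictMono {E : Set X} (hE : Unbounded E) (b : X → X) :
    ∃ e : X → X, StrictMono e ∧ (∀ k, e k ∈ E) ∧ ∀ l k, l < k → b (e l) < e k := by
  obtain ⟨u, v, hu, -, h1, h2⟩ := exists_interleaved hE hE b
  exact ⟨u, fun l k h => (h1 l).1.trans (h2 l k h).1, hu,
    fun l k h => (h1 l).2.trans (h2 l k h).1⟩

theorem StrictMono.id_le' {e : X → X} (he : StrictMono e) (x : X) : x ≤ e x := by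
  have := RegularOrder.wf (X := X)
  exact he.le_apply

theorem Ev.comp {P : X → Prop} (h : Ev P) {e : X → X} (he : StrictMono e) :
    Ev fun y => P (e y) := by
  obtain ⟨b, hb⟩ := h
  exact ⟨b, fun y hy => hb _ (hy.trans_le (StrictMono.id_le' he y))⟩

theorem exists_rep {P : X → Prop} (h : Unbounded {y | P y}) : ∃ e : X → X, StrictMono e ∧
    ∀ y, P (e y) := by
  obtain ⟨e, he, hE, -⟩ := exists_strictMono h id
  exact ⟨e, he, hE⟩

end RegularOrder

/-! ### From Ramsey for transitive relations to regularity and cohesiveness. -/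

/-- Every transitive relation is homogeneous on the increasing pairs of some set of full size. -/
def TransRamsey (X : Type u) [LinearOrder X] : Prop :=
  ∀ r : X → X → Prop, (∀ x y z, r x y → r y z → r x z) → ∃ S : Set X, #S = #X ∧
    ((∀ x ∈ S, ∀ y ∈ S, x < y → r x y) ∨ (∀ x ∈ S, ∀ y ∈ S, x < y → ¬ r x y))

/-- Every family of `#X` sets is eventually decided along some increasing sequence. -/
def Cohesive (X : Type u) [LinearOrder X] : Prop :=
  ∀ B : X → X → Prop, ∃ e : X → X, StrictMono e ∧
    ∀ i, RegularOrder.Ev (fun y => B i (e y)) ∨ RegularOrder.Ev fun y => ¬ B i (e y)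

section Cohesive

open RegularOrder

variable {X : Type u} [LinearOrder X]

/-- Let `s` be unbounded with fewer than `#X` elements, and choose `f x ∈ s` with `x ≤ f x`. On a
full-size set homogeneous for `f x = f y`, either `f` is constant, which bounds that set, or `f` is
injective into `s`. Both are impossible by cardinality. -/
theorem regularOrder_of_transRamsey [wf : WellFoundedLT X] (hs : ∀ a : X, #(Iic a) < #X)
    (hR : TransRamsey X) : RegularOrder X := by
  refine ⟨wf, fun s => ⟨fun ⟨a, ha⟩ => (mk_le_mk_of_subset (t := Iic a) ha).trans_lt (hs a),
    fun h => ?_⟩⟩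
  by_contra hb
  rw [not_bddAbove_iff] at hb
  choose t ht htl using hb
  have hmin : ∀ x, ∃ m ∈ s, x ≤ m ∧ ∀ y ∈ s, x ≤ y → m ≤ y := fun x => by
    obtain ⟨m, ⟨hm, hxm⟩, hm2⟩ := wf.wf.has_min {y | y ∈ s ∧ x ≤ y} ⟨t x, ht x, (htl x).le⟩
    exact ⟨m, hm, hxm, fun y hy hxy => not_lt.1 (hm2 y ⟨hy, hxy⟩)⟩
  choose f hfs hf _ using hmin
  obtain ⟨S, hS, h1 | h2⟩ := hR (fun x y => f x = f y) (fun _ _ _ => Eq.trans)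
  · obtain ⟨a, ha⟩ : S.Nonempty := by
      rw [nonempty_iff_ne_empty]
      rintro rfl
      simp only [mk_eq_zero] at hS
      rw [← hS] at h
      exact not_lt_zero h
    have : S ⊆ Iic (f a) := fun y hy => by
      rcases lt_trichotomy a y with h | rfl | h
      · exact h1 a ha y hy h ▸ hf y
      · exact hf a
      · exact h1 y hy a ha h ▸ hf y
    exact ((mk_le_mk_of_subset this).trans_lt (hs _)).ne hS
  · have : Function.Injective fun x : S => (⟨f x, hfs x⟩ : s) := fun x y hxy => by
      have hxy : f x = f y := congrArg Subtype.val hxy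
      rcases lt_trichotomy x.1 y.1 with h | h | h
      · exact absurd hxy (h2 _ x.2 _ y.2 h)
      · exact Subtype.ext h
      · exact absurd hxy.symm (h2 _ y.2 _ x.2 h)
    exact (hS ▸ mk_le_of_injective this).not_gt h

variable [RegularOrder X]

/-- Induction on the coordinate: once all coordinates below `i` are constant, the `i`-th is
nondecreasing in `y`, and a nondecreasing Boolean function is eventually constant. -/
theorem ev_const_of_lex_monotone (F : X → X → Bool)
    (hF : ∀ i y z, y < z → (∀ j < i, F y j = F z j) → F y i ≤ F z i) (i : X) :
    Ev (fun y => F y i = true) ∨ Ev (fun y => ¬ F y i = true) := by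
  have wf : WellFounded ((· < ·) : X → X → Prop) := (RegularOrder.wf (X := X)).wf
  induction i using wf.induction with
  | _ i ih =>
    have hc : ∀ j, ∃ c, Ev fun y => j < i → F y j = c := fun j => by
      by_cases hj : j < i
      · rcases ih j hj with h | h
        · exact ⟨true, h.mono fun y hy _ => hy⟩
        · exact ⟨false, h.mono fun y hy _ => by simpa using hy⟩
      · exact ⟨true, j, fun y _ h => absurd h hj⟩
    choose c hc using hc
    obtain ⟨b, hb⟩ := Ev.forall_le hc i
    by_cases h : ∃ y, b < y ∧ F y i = true
    · obtain ⟨y, hby, hy⟩ := h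
      refine .inl ⟨y, fun z hz => ?_⟩
      have := hF i y z hz fun j hj => (hb y hby j hj.le hj).trans (hb z (hby.trans hz) j hj.le hj).symm
      rw [hy] at this
      exact top_le_iff.1 this
    · exact .inr ⟨b, fun y hy hF => h ⟨y, hy, hF⟩⟩

/-- Each point `y` is assigned the bit sequence `i ↦ B i y`. Lexicographic comparison of these
sequences is transitive, so they are monotone along some sequence of full size, and then every
coordinate stabilises. -/
theorem cohesive_of_transRamsey (hR : TransRamsey X) : Cohesive X := by
  classical
  intro B
  have := RegularOrder.wf (X := X)
  let F : X → X → Bool := fun y i => decide (B i y)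
  obtain ⟨S, hS, h⟩ := hR (fun x y => toLex (F x) ≤ toLex (F y)) (fun _ _ _ => le_trans)
  obtain ⟨e, he, heS⟩ := exists_rep (P := (· ∈ S)) (mk_eq_iff_unbounded.1 hS)
  refine ⟨e, he, fun i => ?_⟩
  have key : ∀ y z i, toLex (F y) ≤ toLex (F z) → (∀ j < i, F y j = F z j) → F y i ≤ F z i := by
    intro y z i h heq
    rcases h.eq_or_lt with h | ⟨k, hk, hlt⟩
    · exact (congrFun (toLex.injective h) i).le
    · rcases lt_trichotomy k i with hki | rfl | hki
      · exact absurd (heq k hki) hlt.ne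
      · exact hlt.le
      · exact (hk i hki).le
  rcases h with h | h
  · have := ev_const_of_lex_monotone (fun y i => F (e y) i)
      (fun i y z hyz heq => key _ _ _ (h _ (heS y) _ (heS z) (he hyz)) heq) i
    simpa [F] using this
  -- In the decreasing case the complemented bits increase.
  · have := ev_const_of_lex_monotone (fun y i => ! F (e y) i)
      (fun i y z hyz heq => by
        have := key (e z) (e y) i (le_of_not_ge (h _ (heS y) _ (heS z) (he hyz)))
          fun j hj => by simpa using (heq j hj).symm
        revert this
        cases F (e y) i <;> cases F (e z) i <;> simp) i
    simpa [F, or_comm] using this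

omit [RegularOrder X] in
theorem Cohesive.of_index (hC : Cohesive X) {ι : Type u} (hι : #ι ≤ #X) (B : ι → X → Prop) :
    ∃ e : X → X, StrictMono e ∧ ∀ i, Ev (fun y => B i (e y)) ∨ Ev fun y => ¬ B i (e y) := by
  obtain ⟨φ⟩ := hι
  obtain ⟨e, he, h⟩ := hC fun x y => ∃ i, φ i = x ∧ B i y
  refine ⟨e, he, fun i => ?_⟩
  simpa using h (φ i)

/-- On increasing pairs, `g` is a function of only one of its arguments. -/
def UnaryOnIncreasing (g : X → X → X) : Prop :=
  (∃ h : X → X, ∀ x y, x < y → g x y = h x) ∨ ∃ h : X → X, ∀ x y, x < y → g x y = h y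

/-- Distinct increasing pairs have distinct values. -/
def InjOnIncreasing (g : X → X → X) : Prop :=
  ∀ x y z w, x < y → z < w → g x y = g z w → x = z ∧ y = w

omit [RegularOrder X] in
theorem UnaryOnIncreasing.comp {g : X → X → X} (hg : UnaryOnIncreasing g) {e : X → X}
    (he : StrictMono e) : UnaryOnIncreasing fun x y => g (e x) (e y) :=
  hg.imp (fun ⟨h, hh⟩ => ⟨fun x => h (e x), fun _ _ hxy => hh _ _ (he hxy)⟩)
    fun ⟨h, hh⟩ => ⟨fun x => h (e x), fun _ _ hxy => hh _ _ (he hxy)⟩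

end Cohesive

/-! ### The canonical Ramsey theorem and separating functions. -/

section Canonical

open RegularOrder

variable {X : Type u} [LinearOrder X] [RegularOrder X]

omit [RegularOrder X] in
theorem InjOnIncreasing.comp {g : X → X → X} (hg : InjOnIncreasing g) {e : X → X}
    (he : StrictMono e) : InjOnIncreasing fun x y => g (e x) (e y) := fun _ _ _ _ hxy hzw h =>
  (hg _ _ _ _ (he hxy) (he hzw) h).imp (fun h => he.injective h) fun h => he.injective h

omit [LinearOrder X] [RegularOrder X] in
theorem mk_prod_self_le [Infinite X] : #(X × X) ≤ #X := by
  simp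

omit [RegularOrder X] in
theorem ev_imp [Nonempty X] {P : X → Prop} {Q : Prop} (h : Q → Ev P) : Ev fun y => Q → P y := by
  by_cases hQ : Q
  · exact (h hQ).mono fun _ hy _ => hy
  · exact ⟨Classical.arbitrary X, fun _ _ h' => absurd h' hQ⟩

/-- The canonical Ramsey theorem for pairs. -/
theorem Cohesive.canonical [Infinite X] (hC : Cohesive X) (g : X → X → X) :
    ∃ e : X → X, StrictMono e ∧ (UnaryOnIncreasing (fun x y => g (e x) (e y)) ∨
      InjOnIncreasing fun x y => g (e x) (e y)) := by
  obtain ⟨e₁, he₁, h₁⟩ := hC.of_index mk_prod_self_le fun (p : X × X) y => g p.1 y = p.2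
  obtain ⟨g₁, hg₁⟩ : ∃ g₁ : X → X → X, g₁ = fun x y => g (e₁ x) (e₁ y) := ⟨_, rfl⟩
  have h₁ : ∀ x c, Ev (fun y => g₁ x y = c) ∨ Ev fun y => ¬ g₁ x y = c := fun x c =>
    hg₁ ▸ h₁ (e₁ x, c)
  suffices ∃ e : X → X, StrictMono e ∧ (UnaryOnIncreasing (fun x y => g₁ (e x) (e y)) ∨
      InjOnIncreasing fun x y => g₁ (e x) (e y)) by
    obtain ⟨e, he, h⟩ := this
    subst hg₁
    exact ⟨e₁ ∘ e, he₁.comp he, h⟩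
  -- If unboundedly many rows have an eventual value, a sequence outgrowing their thresholds makes
  -- `g₁` depend on `x` only.
  by_cases ha : Unbounded {x | ∃ c, Ev fun y => g₁ x y = c}
  · have : ∀ x, ∃ c b, (∃ c, Ev fun y => g₁ x y = c) → ∀ y, b < y → g₁ x y = c := fun x => by
      by_cases hx : ∃ c, Ev fun y => g₁ x y = c
      · obtain ⟨c, b, h⟩ := hx
        exact ⟨c, b, fun _ => h⟩
      · exact ⟨x, x, fun h => absurd h hx⟩
    choose c b hb using this
    obtain ⟨e, he, heE, heb⟩ := exists_strictMono ha b
    exact ⟨e, he, .inl <| .inl ⟨fun x => c (e x), fun x y hxy => hb _ (heE x) _ (heb x y hxy)⟩⟩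
  obtain ⟨b₀, hb₀⟩ := not_unbounded_iff.1 ha
  have hb₀ : ∀ x, b₀ < x → ∀ c, Ev fun y => ¬ g₁ x y = c := fun x hx c =>
    (h₁ x c).resolve_left fun h => hb₀ x hx ⟨c, h⟩
  obtain ⟨e₂, he₂, h₂⟩ := hC.of_index mk_prod_self_le fun (p : X × X) y => g₁ p.1 y = g₁ p.2 y
  obtain ⟨g₂, hg₂⟩ : ∃ g₂ : X → X → X, g₂ = fun x y => g₁ (e₂ x) (e₂ y) := ⟨_, rfl⟩
  have h₂ : ∀ x z, Ev (fun y => g₂ x y = g₂ z y) ∨ Ev fun y => ¬ g₂ x y = g₂ z y := fun x z =>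
    hg₂ ▸ h₂ (e₂ x, e₂ z)
  have hb₀ : ∀ x, b₀ < x → ∀ c, Ev fun y => ¬ g₂ x y = c := fun x hx c => by
    subst hg₂
    exact (hb₀ (e₂ x) (hx.trans_le (StrictMono.id_le' he₂ x)) c).comp he₂
  suffices ∃ e : X → X, StrictMono e ∧ (UnaryOnIncreasing (fun x y => g₂ (e x) (e y)) ∨
      InjOnIncreasing fun x y => g₂ (e x) (e y)) by
    obtain ⟨e, he, h⟩ := this
    subst hg₂
    exact ⟨e₂ ∘ e, he₂.comp he, h⟩
  -- If unboundedly many rows eventually agree with one row `x₀`, the function depends on `y` only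
  -- along a sparse sequence.
  by_cases hb : ∃ x₀, Unbounded {x | Ev fun y => g₂ x y = g₂ x₀ y}
  · obtain ⟨x₀, hx₀⟩ := hb
    have : ∀ x, ∃ b, (Ev fun y => g₂ x y = g₂ x₀ y) → ∀ y, b < y → g₂ x y = g₂ x₀ y := fun x => by
      by_cases hx : Ev fun y => g₂ x y = g₂ x₀ y
      · obtain ⟨b, h⟩ := hx
        exact ⟨b, fun _ => h⟩
      · exact ⟨x, fun h => absurd h hx⟩
    choose b hb using this
    obtain ⟨e, he, heE, heb⟩ := exists_strictMono hx₀ b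
    exact ⟨e, he, .inl <| .inr ⟨fun y => g₂ x₀ (e y), fun x y hxy => hb _ (heE x) _ (heb x y hxy)⟩⟩
  have hb : ∀ x₀, Ev fun x => Ev fun y => ¬ g₂ x y = g₂ x₀ y := fun x₀ =>
    (not_unbounded_iff.1 (not_exists.1 hb x₀)).mono fun x hx => (h₂ x x₀).resolve_left hx
  -- The first two clauses make distinct rows differ in every later column; the third keeps a later
  -- column from repeating a value of an earlier one.
  obtain ⟨b, hbP⟩ := exists_modulus (X := X) (P := fun x z w y =>
      ((Ev fun y => ¬ g₂ x y = g₂ z y) → ¬ g₂ x y = g₂ z y) ∧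
      (Ev fun y' => ¬ g₂ y y' = g₂ x y') ∧ (b₀ < x → ¬ g₂ x y = g₂ z w)) fun x z w => by
    exact .and (ev_imp id) ((hb x).and (ev_imp fun h => hb₀ x h _))
  obtain ⟨e, he, heE, heb⟩ := exists_strictMono (E := {x | b₀ < x})
    (fun a => by
      obtain ⟨x, hx⟩ := exists_gt' (max a b₀)
      exact ⟨x, (max_lt_iff.1 hx).2, (max_lt_iff.1 hx).1⟩) b
  have key1 : ∀ x z y, x < z → z < y → ¬ g₂ (e z) (e y) = g₂ (e x) (e y) := fun x z y hxz hzy =>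
    (hbP (e z) (e z) (e x) (e x) le_rfl (he hxz).le (he hxz).le (e y) (heb z y hzy)).1
      (hbP (e x) (e x) (e x) (e x) le_rfl le_rfl le_rfl (e z) (heb x z hxz)).2.1
  have key2 : ∀ x y z w, x < y → z < w → y < w → ¬ g₂ (e z) (e w) = g₂ (e x) (e y) :=
    fun x y z w hxy hzw hyw =>
      (hbP (e (max y z)) (e z) (e x) (e y) (he.monotone (le_max_right _ _))
        (he.monotone (hxy.le.trans (le_max_left _ _))) (he.monotone (le_max_left _ _)) (e w)
        (heb _ w (max_lt hyw hzw))).2.2 (heE z)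
  refine ⟨e, he, .inr fun x y z w hxy hzw h => ?_⟩
  rcases lt_trichotomy y w with hyw | rfl | hyw
  · exact absurd h.symm (key2 x y z w hxy hzw hyw)
  · refine ⟨?_, rfl⟩
    rcases lt_trichotomy x z with hxz | hxz | hxz
    · exact absurd h.symm (key1 x z y hxz hzw)
    · exact hxz
    · exact absurd h (key1 z x y hxz hxy)
  · exact absurd h (key2 z w x y hzw hxy hyw)

/-- `α` is injective on the pairs `x ≤ y`, and takes other values on the pairs `x > y`. -/
def Separating (α : X → X → X) : Prop :=
  (∀ x y z w, x ≤ y → z ≤ w → α x y = α z w → x = z ∧ y = w) ∧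
    ∀ x y z w, x ≤ y → w < z → α x y ≠ α z w

omit [RegularOrder X] in
theorem InjOnIncreasing.ev_ne {f : X → X → X} (hf : InjOnIncreasing f) (x d : X) :
    Ev fun y => f x y ≠ d := by
  by_cases h : ∃ y, x < y ∧ f x y = d
  · obtain ⟨y, hxy, rfl⟩ := h
    exact ⟨y, fun z hz h => hz.ne' (hf x z x y (hxy.trans hz) hxy h).2⟩
  · exact ⟨x, fun y hy hd => h ⟨y, hy, hd⟩⟩

/-- Separation along interleaved sequences follows from an eventual property of the values. -/
theorem InjOnIncreasing.exists_separating_of_ev {f : X → X → X} (hf : InjOnIncreasing f)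
    {E V : Set X} (hE : Unbounded E) (hV : Unbounded V) {P : X → X → X → X → Prop}
    (hP : ∀ x z w, Ev (P x z w))
    (hsep : ∀ S : Set X, (∀ a ∈ S, ∀ b ∈ S, ∀ c ∈ S, ∀ d ∈ S, a < d → b < d → c < d → P a b c d) →
      ∀ x ∈ S, ∀ y ∈ S, ∀ z ∈ S, ∀ w ∈ S, x ∈ E → y ∈ V → z ∈ E → w ∈ V → x < y → w < z →
        y ≠ z → f x y ≠ f z w) :
    ∃ u v : X → X, Separating fun x y => f (u x) (v y) := by
  obtain ⟨b, hb⟩ := exists_modulus hP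
  obtain ⟨u, v, hu, hv, huv, hvu⟩ := exists_interleaved hE hV b
  have hum : StrictMono u := fun l k h => (huv l).1.trans (hvu l k h).1
  have hvm : StrictMono v := fun l k h => (hvu l k h).1.trans (huv k).1
  have huv' : ∀ i j, i ≤ j → u i < v j := fun i j h => (hum.monotone h).trans_lt (huv j).1
  refine ⟨u, v, fun x y z w hxy hzw h => ?_, fun x y z w hxy hwz => ?_⟩
  · have := hf _ _ _ _ (huv' x y hxy) (huv' z w hzw) h
    exact ⟨hum.injective this.1, hvm.injective this.2⟩
  refine hsep (range u ∪ range v) ?_ _ (.inl ⟨x, rfl⟩) _ (.inr ⟨y, rfl⟩) _ (.inl ⟨z, rfl⟩) _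
    (.inr ⟨w, rfl⟩) (hu x) (hv y) (hu z) (hv w) (huv' x y hxy) (hvu w z hwz).1 ?_
  swap
  · exact (lt_or_ge y z).elim (fun h => (hvu y z h).1.ne) fun h => (huv' z y h).ne'
  -- All members of the sequences below `d` lie below its predecessor in the interleaving, and `d`
  -- exceeds the modulus there.
  rintro p hp q hq r hr d (⟨k, rfl⟩ | ⟨k, rfl⟩) hpd hqd hrd
  · have hlt : ∀ a ∈ range u ∪ range v, a < u k → ∃ l < k, a ≤ v l := by
      rintro _ (⟨i, rfl⟩ | ⟨i, rfl⟩) h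
      · exact ⟨i, hum.lt_iff_lt.1 h, (huv i).1.le⟩
      · exact ⟨i, not_le.1 fun h' => lt_asymm h (huv' _ _ h'), le_rfl⟩
    obtain ⟨i, hi, hpi⟩ := hlt p hp hpd
    obtain ⟨j, hj, hqj⟩ := hlt q hq hqd
    obtain ⟨l, hl, hrl⟩ := hlt r hr hrd
    have hm := hvm.monotone
    exact hb (v (max i (max j l))) _ _ _ (hpi.trans (hm (le_max_left _ _)))
      (hqj.trans (hm ((le_max_left _ _).trans (le_max_right _ _))))
      (hrl.trans (hm ((le_max_right _ _).trans (le_max_right _ _)))) _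
      (hvu _ k (max_lt hi (max_lt hj hl))).2
  · have hle : ∀ a ∈ range u ∪ range v, a < v k → a ≤ u k := by
      rintro _ (⟨i, rfl⟩ | ⟨i, rfl⟩) h
      · exact hum.monotone (not_lt.1 fun h' => lt_asymm h (hvu _ _ h').1)
      · exact (hvu _ _ (hvm.lt_iff_lt.1 h)).1.le
    exact hb (u k) _ _ _ (hle p hp hpd) (hle q hq hqd) (hle r hr hrd) _ (huv k).2

omit [RegularOrder X] in
theorem unbounded_inter_or_ev (V : Set X) (Q : X → X → Prop) :
    (∃ d, Unbounded {v | v ∈ V ∧ Q d v}) ∨ ∀ d, Ev fun v => v ∈ V → ¬ Q d v := by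
  refine or_iff_not_imp_left.2 fun h d => ?_
  exact (not_unbounded_iff.1 (not_exists.1 h d)).mono fun v hv hvV hQ => hv ⟨hvV, hQ⟩

theorem unbounded_of_ev {P : X → Prop} (h : Ev P) : Unbounded {x | P x} := fun a => by
  obtain ⟨b, hb⟩ := h
  obtain ⟨x, hx⟩ := exists_gt' (max a b)
  exact ⟨x, hb x (max_lt_iff.1 hx).2, (max_lt_iff.1 hx).1⟩

/-- Only a collision between an increasing pair `(x, y)` and a decreasing pair `(z, w)` must be
avoided. After thinning, every column `w` either has an eventual value `h w` or eventually avoids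
each given value. Columns of the second kind cause no collision when the sequences grow fast. For
the first kind, decreasing pairs take the value `h w`. If `h` is constantly `c` on unboundedly many
columns, it suffices to avoid `c`. Otherwise `h` eventually avoids each value, and the only
remaining danger is `g x y = h y`. -/
theorem InjOnIncreasing.exists_separating [Infinite X] (hC : Cohesive X) {f : X → X → X}
    (hf : InjOnIncreasing f) : ∃ u v : X → X, Separating fun x y => f (u x) (v y) := by
  obtain ⟨e, he, h₁⟩ := hC.of_index mk_prod_self_le fun (p : X × X) x => f x p.1 = p.2
  obtain ⟨g, hg⟩ : ∃ g : X → X → X, g = fun x y => f (e x) (e y) := ⟨_, rfl⟩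
  have h₁' : ∀ y c, Ev (fun x => g x y = c) ∨ Ev fun x => ¬ g x y = c := fun y c =>
    hg ▸ h₁ (e y, c)
  have hf : InjOnIncreasing g := hg ▸ hf.comp he
  suffices ∃ u v : X → X, Separating fun x y => g (u x) (v y) by
    obtain ⟨u, v, h⟩ := this
    subst hg
    exact ⟨e ∘ u, e ∘ v, h⟩
  clear hg he
  by_cases hV : Unbounded {v | ∃ c, Ev fun x => g x v = c}
  swap
  · have hV := unbounded_of_ev (not_unbounded_iff.1 hV)
    refine hf.exists_separating_of_ev unbounded_univ hV
      (P := fun x z w y => g x y ≠ g z w ∧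
        (w ∈ {v | ¬ ∃ c, Ev fun x => g x v = c} → ¬ g y w = g x z))
      (fun x z w => (hf.ev_ne x _).and (ev_imp fun hw => (h₁' w _).resolve_left fun h => hw ⟨_, h⟩))
      fun S hS x hx y hy z hz w hw _ _ _ hwV hxy hwz hyz => ?_
    rcases hyz.lt_or_gt with hyz | hzy
    · exact Ne.symm ((hS x hx y hy w hw z hz (hxy.trans hyz) hyz hwz).2 hwV)
    · exact (hS x hx z hz w hw y hy hxy hzy (hwz.trans hzy)).1
  choose! h hh using fun (v : X) (hv : v ∈ {v | ∃ c, Ev fun x => g x v = c}) => hv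
  obtain ⟨V, hVdef⟩ : ∃ V : Set X, V = {v | ∃ c, Ev fun x => g x v = c} := ⟨_, rfl⟩
  rw [← hVdef] at hV hh
  rcases unbounded_inter_or_ev V fun c v => h v = c with ⟨c, hc⟩ | hc
  · refine hf.exists_separating_of_ev unbounded_univ hc
      (P := fun x z w y => g x y ≠ c ∧ (w ∈ V → g y w = h w))
      (fun x z w => (hf.ev_ne x _).and (ev_imp (hh w)))
      fun S hS x hx y hy z hz w hw _ _ _ hwV hxy hwz hyz => ?_
    rw [(hS w hw w hw w hw z hz hwz hwz hwz).2 hwV.1, hwV.2]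
    exact (hS x hx x hx x hx y hy hxy hxy hxy).1
  -- If some row `u₀` agrees with `h` on unboundedly many columns, keep these columns: injectivity
  -- then prevents later rows from agreeing there.
  obtain ⟨u₀, V', hV', hVV, hu⟩ : ∃ u₀, ∃ V' : Set X, Unbounded V' ∧ V' ⊆ V ∧
      ∀ u, u₀ < u → Ev fun v => v ∈ V' → ¬ g u v = h v := by
    rcases unbounded_inter_or_ev V fun u v => g u v = h v with ⟨u₀, hu⟩ | hu
    · refine ⟨u₀, _, hu, fun v hv => hv.1, fun u hu₀ => ⟨u, fun v huv hv hg => ?_⟩⟩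
      exact hu₀.ne (hf _ _ _ _ (hu₀.trans huv) huv (hv.2.trans hg.symm)).1
    · exact ⟨Classical.arbitrary X, V, hV, subset_rfl, fun u _ => hu u⟩
  refine hf.exists_separating_of_ev (unbounded_of_ev (ev_gt u₀)) hV'
    (P := fun x z w y => (w ∈ V → g y w = h w) ∧ (u₀ < x → y ∈ V' → ¬ g x y = h y) ∧
      (y ∈ V → ¬ h y = g x z) ∧ g x y ≠ h z)
    (fun x z w => (ev_imp (hh w)).and ((ev_imp (hu x)).and ((hc _).and (hf.ev_ne x _))))
    fun S hS x hx y hy z hz w hw hxE hyV _ hwV hxy hwz hyz => ?_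
  rw [(hS w hw w hw w hw z hz hwz hwz hwz).1 (hVV hwV)]
  rcases lt_trichotomy y w with hyw | rfl | hwy
  · exact Ne.symm
      ((hS x hx y hy x hx w hw (hxy.trans hyw) hyw (hxy.trans hyw)).2.2.1 (hVV hwV))
  · exact (hS x hx x hx x hx y hy hxy hxy hxy).2.1 hxE hyV
  · exact (hS x hx w hw x hx y hy hxy hwy hxy).2.2.2

end Canonical

/-! ### Clones defined by forbidden binary minors. -/

/-- The binary function obtained from `f` by substituting a unary function of one of two variables
for each argument. -/
def minor {X : Type u} {n : ℕ} (f : Op X n) (p : Fin (n + 1) → X → X) (σ : Fin (n + 1) → Bool) :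
    X → X → X :=
  fun x y => f fun i => p i (bif σ i then x else y)

namespace Clone

variable {X : Type u}

/-- `h`, as a binary function, belongs to `C`. -/
def Mem₂ (C : Clone X) (h : X → X → X) : Prop :=
  (fun x : Fin 2 → X => h (x 0) (x 1)) ∈ C.ops 1

theorem fullUnary_le_iff {C : Clone X} : fullUnary X ≤ C ↔ C.ContainsAllUnary := by
  refine ⟨fun h p => h 0 ⟨p, 0, rfl⟩, fun h n f => ?_⟩
  rintro ⟨p, k, rfl⟩
  exact C.comp_mem n 0 _ (fun _ => _) (h p) fun _ => C.proj_mem n k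

theorem ContainsAllUnary.mono {C D : Clone X} (hC : C.ContainsAllUnary) (h : C ≤ D) :
    D.ContainsAllUnary := fun p => h 0 (hC p)

theorem ContainsAllUnary.comp_mem {C : Clone X} (hC : C.ContainsAllUnary) {n : ℕ} {f : Op X n}
    (hf : f ∈ C.ops n) (p : X → X) : (fun x => p (f x)) ∈ C.ops n :=
  C.comp_mem n 0 _ (fun _ => f) (hC p) fun _ => hf

theorem ContainsAllUnary.minor_mem {C : Clone X} (hC : C.ContainsAllUnary) {n : ℕ} {f : Op X n}
    (hf : f ∈ C.ops n) (p : Fin (n + 1) → X → X) (σ : Fin (n + 1) → Bool) :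
    C.Mem₂ (minor f p σ) := by
  refine C.comp_mem 1 n f (fun i x => p i (bif σ i then x 0 else x 1)) hf fun i => ?_
  refine hC.comp_mem (f := fun x => bif σ i then x 0 else x 1) ?_ (p i)
  cases σ i
  · exact C.proj_mem 1 1
  · exact C.proj_mem 1 0

theorem Mem₂.comp {C : Clone X} {h p q : X → X → X} (hh : C.Mem₂ h) (hp : C.Mem₂ p)
    (hq : C.Mem₂ q) : C.Mem₂ fun x y => h (p x y) (q x y) :=
  C.comp_mem 1 1 _ ![fun x => p (x 0) (x 1), fun x => q (x 0) (x 1)] hh fun i => by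
    fin_cases i
    · exact hp
    · exact hq

theorem mem₂_fst (C : Clone X) : C.Mem₂ fun x _ => x := C.proj_mem 1 0

theorem mem₂_snd (C : Clone X) : C.Mem₂ fun _ y => y := C.proj_mem 1 1

theorem eq_top_of_forall {C : Clone X} (h : ∀ n (f : Op X n), f ∈ C.ops n) : C = ⊤ :=
  top_le_iff.1 fun n f _ => h n f

/-- Iterating `h` gives an injective `q` of each arity, and any `f` of that arity is a unary
function applied to `q`. -/
theorem ContainsAllUnary.eq_top_of_injective {C : Clone X} (hC : C.ContainsAllUnary)
    {h : X → X → X} (hh : C.Mem₂ h) (hinj : ∀ x y z w, h x y = h z w → x = z ∧ y = w) :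
    C = ⊤ := by
  refine eq_top_of_forall fun n f => ?_
  have key : ∀ k ≤ n, ∃ q ∈ C.ops n, ∀ x y : Fin (n + 1) → X, q x = q y →
      ∀ i : Fin (n + 1), i.1 ≤ k → x i = y i := by
    intro k
    induction k with
    | zero =>
      refine fun _ => ⟨_, C.proj_mem n 0, fun x y h i hi => ?_⟩
      obtain rfl : i = 0 := Fin.ext (Nat.le_zero.1 hi)
      exact h
    | succ k ih =>
      intro hk
      obtain ⟨q, hq, hqi⟩ := ih (Nat.le_of_succ_le hk)
      refine ⟨fun x => h (q x) (x ⟨k + 1, Nat.lt_succ_of_le hk⟩),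
        C.comp_mem n 1 _ ![q, fun x => x ⟨k + 1, Nat.lt_succ_of_le hk⟩] hh fun i => ?_,
        fun x y hxy i hi => ?_⟩
      · fin_cases i
        · exact hq
        · exact C.proj_mem n _
      · rcases Nat.le_succ_iff.1 hi with hi | hi
        · exact hqi x y (hinj _ _ _ _ hxy).1 i hi
        · obtain rfl : i = ⟨k + 1, Nat.lt_succ_of_le hk⟩ := Fin.ext hi
          exact (hinj _ _ _ _ hxy).2
  obtain ⟨q, hq, hqi⟩ := key n le_rfl
  have hq' : Function.Injective q := fun x y h => funext fun i => hqi x y h i (Fin.is_le i)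
  have : f = fun x => Function.extend q f id (q x) := funext fun x => (hq'.extend_apply f id x).symm
  rw [this]
  exact hC.comp_mem hq _

/-- The clone of all functions without minors in a class `B` of binary functions. -/
def minorFree (B : (X → X → X) → Prop) (hfst : ∀ p : X → X, ¬ B fun x _ => p x)
    (hsnd : ∀ p : X → X, ¬ B fun _ y => p y)
    (hB : ∀ (k : ℕ) (f : Op X k) (g : Fin (k + 1) → X → X → X), (∀ i, ¬ B (g i)) →
      B (fun x y => f fun i => g i x y) → ∃ p σ, B (minor f p σ)) : Clone X where
  ops n := {f | ∀ p σ, ¬ B (minor f p σ)}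
  proj_mem n k p σ := by
    unfold minor
    cases hσ : σ k <;> simp only [hσ, cond_true, cond_false]
    · exact hsnd (p k)
    · exact hfst (p k)
  comp_mem n k g f hg hf p σ h := by
    obtain ⟨p', σ', h'⟩ := hB k g (fun i => minor (f i) p σ) (fun i => hf i p σ) h
    exact hg p' σ' h'

section minorFree

variable {B : (X → X → X) → Prop} {hfst : ∀ p : X → X, ¬ B fun x _ => p x}
    {hsnd : ∀ p : X → X, ¬ B fun _ y => p y}
    {hB : ∀ (k : ℕ) (f : Op X k) (g : Fin (k + 1) → X → X → X), (∀ i, ¬ B (g i)) →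
      B (fun x y => f fun i => g i x y) → ∃ p σ, B (minor f p σ)}

theorem minorFree_containsAllUnary : (minorFree B hfst hsnd hB).ContainsAllUnary := fun q p σ => by
  unfold minor
  cases hσ : σ 0 <;> simp only [hσ, cond_true, cond_false]
  · exact hsnd fun y => q (p 0 y)
  · exact hfst fun x => q (p 0 x)

theorem not_of_mem₂_minorFree {h : X → X → X} (hh : (minorFree B hfst hsnd hB).Mem₂ h) : ¬ B h :=
  hh (fun _ => id) ![true, false]

theorem mem₂_minorFree {h : X → X → X} (h0 : ∀ p q : X → X, ¬ B fun x y => h (p x) (q y))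
    (h1 : ∀ p q : X → X, ¬ B fun x y => h (p y) (q x)) : (minorFree B hfst hsnd hB).Mem₂ h := by
  intro p σ
  unfold minor
  cases h2 : σ 0 <;> cases h3 : σ 1 <;> simp only [h2, h3, cond_true, cond_false]
  · exact hsnd fun y => h (p 0 y) (p 1 y)
  · exact h1 _ _
  · exact h0 _ _
  · exact hfst fun y => h (p 0 y) (p 1 y)

theorem le_minorFree {C : Clone X} (hC : C.ContainsAllUnary) (h : ∀ g, C.Mem₂ g → ¬ B g) :
    C ≤ minorFree B hfst hsnd hB :=
  fun _ _ hf p σ => h _ (hC.minor_mem hf p σ)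

/-- A strictly larger clone must have a binary member in `B`: otherwise, being closed under minors,
it would lie below `minorFree` again. -/
theorem minorFree_precomplete (hne : ∃ h, B h)
    (htop : ∀ C : Clone X, minorFree B hfst hsnd hB ≤ C → (∃ h, C.Mem₂ h ∧ B h) → C = ⊤) :
    (minorFree B hfst hsnd hB).Precomplete := by
  refine ⟨fun h => ?_, fun C hC => htop C hC.le ?_⟩
  · obtain ⟨g, hg⟩ := hne
    refine not_of_mem₂_minorFree (hfst := hfst) (hsnd := hsnd) (hB := hB) (h := g) ?_ hg
    rw [h]
    exact mem_univ _
  · by_contra hcon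
    push Not at hcon
    exact hC.not_ge (le_minorFree (minorFree_containsAllUnary.mono hC.le) hcon)

theorem Precomplete.eq_minorFree {C : Clone X} (hC : C.Precomplete)
    (hM : (minorFree B hfst hsnd hB).Precomplete) (hU : C.ContainsAllUnary)
    (h : ∀ g, C.Mem₂ g → ¬ B g) : C = minorFree B hfst hsnd hB :=
  ((hC.le_iff_eq hM.1).1 (le_minorFree hU h)).symm

end minorFree

end Clone

/-! ### Heavy and wild functions together generate everything. -/

section Order

open RegularOrder

variable {X : Type u} [LinearOrder X]

/-- `h` depends heavily on both of its arguments. -/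
def Heavy (h : X → X → X) : Prop :=
  (∃ b, Unbounded (range fun x => h x b)) ∧ ∃ a, Unbounded (range fun y => h a y)

/-- After unary substitutions, `h` is injective on the increasing pairs. -/
def Wild (h : X → X → X) : Prop :=
  ∃ u v : X → X, InjOnIncreasing fun x y => h (u x) (v y)

variable [RegularOrder X]

theorem heavilyBinary_iff {C : Clone X} : C.HeavilyBinary ↔ ∃ h, C.Mem₂ h ∧ Heavy h := by
  have h0 : ∀ (H : Op X 1) (a : Fin 2 → X), (fun x => H (Function.update a 0 x)) =
      fun x => H ![x, a 1] := fun H a => funext fun x => congrArg H (by ext i; fin_cases i <;> rfl)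
  have h1 : ∀ (H : Op X 1) (a : Fin 2 → X), (fun x => H (Function.update a 1 x)) =
      fun x => H ![a 0, x] := fun H a => funext fun x => congrArg H (by ext i; fin_cases i <;> rfl)
  constructor
  · rintro ⟨H, hH, ⟨a, ha⟩, b, hb⟩
    rw [h0, mk_eq_iff_unbounded] at ha
    rw [h1, mk_eq_iff_unbounded] at hb
    refine ⟨fun x y => H ![x, y], ?_, ⟨_, ha⟩, _, hb⟩
    have : (fun x : Fin 2 → X => H ![x 0, x 1]) = H :=
      funext fun x => congrArg H (by ext i; fin_cases i <;> rfl)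
    unfold Clone.Mem₂
    rwa [this]
  · rintro ⟨h, hh, ⟨b, hb⟩, a, ha⟩
    refine ⟨_, hh, ⟨fun _ => b, ?_⟩, fun _ => a, ?_⟩
    · rw [mk_eq_iff_unbounded]; exact hb
    · rw [mk_eq_iff_unbounded]; exact ha

/-- The value `α x y` reveals whether `x ≤ y`, and if so also the pair. So `h (p (α x y)) (q (α y
x))` can code the pair through the first argument of `h` when `x ≤ y`, and through the second when
`y < x`, the other argument being pinned at `b` or `a`. -/
theorem Clone.ContainsAllUnary.eq_top_of_separating {C : Clone X} (hC : C.ContainsAllUnary)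
    {h α : X → X → X} (hh : C.Mem₂ h) (hheavy : Heavy h) (hα : C.Mem₂ α) (hsep : Separating α) :
    C = ⊤ := by
  classical
  obtain ⟨⟨b, hb⟩, a, ha⟩ := hheavy
  -- Interleaving makes the code values of the two cases disjoint.
  obtain ⟨u, v, hu, hv, huv, hvu⟩ := exists_interleaved hb ha id
  choose s hs using hu
  choose t ht using hv
  simp only at hs ht
  have hum : StrictMono u := fun l k h => (huv l).1.trans (hvu l k h).1
  have hvm : StrictMono v := fun l k h => (hvu l k h).1.trans (huv k).1
  have hne : ∀ i j, u i ≠ v j := fun i j => (lt_or_ge j i).elim (fun h => (hvu j i h).1.ne')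
    fun h => ((hum.monotone h).trans_lt (huv j).1).ne
  let p : X → X := fun z => if ∃ x y, x ≤ y ∧ α x y = z then s z else a
  -- The strict inequality, unlike the one in `p`, leaves the diagonal to the first case.
  let q : X → X := fun z => if ∃ x y, x < y ∧ α x y = z then t z else b
  have hp0 : ∀ x y, x ≤ y → p (α x y) = s (α x y) := fun x y h => if_pos ⟨x, y, h, rfl⟩
  have hp1 : ∀ x y, y < x → p (α x y) = a := fun x y h =>
    if_neg fun ⟨z, w, hzw, he⟩ => hsep.2 z w x y hzw h he
  have hq0 : ∀ x y, x < y → q (α x y) = t (α x y) := fun x y h => if_pos ⟨x, y, h, rfl⟩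
  have hq1 : ∀ x y, y ≤ x → q (α x y) = b := fun x y h =>
    if_neg fun ⟨z, w, hzw, he⟩ => by
      rcases h.lt_or_eq with h | rfl
      · exact hsep.2 z w x y hzw.le h he
      · obtain ⟨rfl, rfl⟩ := hsep.1 z w _ _ hzw.le le_rfl he
        exact lt_irrefl _ hzw
  have hmem : C.Mem₂ fun x y => h (p (α x y)) (q (α y x)) :=
    hh.comp (hC.comp_mem hα p) (hC.comp_mem (hα.comp C.mem₂_snd C.mem₂_fst) q)
  have hle : ∀ x y, x ≤ y → h (p (α x y)) (q (α y x)) = u (α x y) := fun x y hxy => by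
    rw [hp0 x y hxy, hq1 y x hxy, hs]
  have hgt : ∀ x y, y < x → h (p (α x y)) (q (α y x)) = v (α y x) := fun x y hxy => by
    rw [hp1 x y hxy, hq0 y x hxy, ht]
  refine hC.eq_top_of_injective hmem fun x y z w he => ?_
  rcases le_or_gt x y with h1 | h1 <;> rcases le_or_gt z w with h2 | h2
  · rw [hle x y h1, hle z w h2] at he
    exact hsep.1 x y z w h1 h2 (hum.injective he)
  · rw [hle x y h1, hgt z w h2] at he
    exact absurd he (hne _ _)
  · rw [hgt x y h1, hle z w h2] at he
    exact absurd he.symm (hne _ _)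
  · rw [hgt x y h1, hgt z w h2] at he
    exact (hsep.1 y x w z h1.le h2.le (hvm.injective he)).symm

theorem Clone.ContainsAllUnary.eq_top_of_wild [Infinite X] (hcoh : Cohesive X) {C : Clone X}
    (hC : C.ContainsAllUnary) {h g : X → X → X} (hh : C.Mem₂ h) (hheavy : Heavy h)
    (hg : C.Mem₂ g) (hw : Wild g) : C = ⊤ := by
  obtain ⟨u, v, hw⟩ := hw
  obtain ⟨p, q, hsep⟩ := hw.exists_separating hcoh
  refine hC.eq_top_of_separating hh hheavy (α := fun x y => g (u (p x)) (v (q y))) ?_ hsep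
  exact hg.comp (hC.comp_mem C.mem₂_fst (u ∘ p)) (hC.comp_mem C.mem₂_snd (v ∘ q))

end Order

/-! ### The light and the tame clone. -/

open Classical in
/-- A binary function with neutral element `z`, constant where both arguments differ from `z`. -/
noncomputable def wedge {X : Type u} (z x y : X) : X := if x = z then y else if y = z then x else z

theorem wedge_comm {X : Type u} (z x y : X) : wedge z x y = wedge z y x := by
  unfold wedge
  grind

section Order

open RegularOrder

variable {X : Type u} [LinearOrder X] [RegularOrder X]

theorem RegularOrder.mk_pi_Iic_lt [Infinite X] (n : ℕ) (m : X) : #(Fin n → Iic m) < #X := by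
  have h : #(Iic m) < #X := (bddAbove_iff _).1 bddAbove_Iic
  have hX := aleph0_le_mk X
  simp only [mk_pi, prod_const, mk_fin, lift_natCast, lift_uzero, power_natCast]
  rcases lt_or_ge #(Iic m) ℵ₀ with h' | h'
  · exact (power_lt_aleph0 h' (natCast_lt_aleph0 (n := n))).trans_le hX
  · exact (power_nat_le h').trans_lt h

/-- If finitely many parameters take few values each, some fixed values of the parameters already
give many values. -/
theorem exists_unbounded_of_params [Infinite X] {n : ℕ} (F : (Fin n → X) → X → X)
    (G : X → Fin n → X) (m : Fin n → X) (hG : ∀ y i, G y i ≤ m i)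
    (hF : Unbounded (range fun y => F (G y) y)) : ∃ c, Unbounded (range fun y => F c y) := by
  by_contra hcon
  have hcon : ∀ c, ∃ b, ∀ y, F c y ≤ b := fun c => by
    obtain ⟨b, hb⟩ := not_not.1 (mt not_bddAbove_iff_unbounded.1 (not_exists.1 hcon c))
    exact ⟨b, fun y => hb ⟨y, rfl⟩⟩
  choose b hb using hcon
  obtain ⟨M, hM⟩ := (finite_range m).bddAbove
  -- There are fewer than `#X` parameter tuples below `M`, so their individual bounds have a common
  -- one.
  have : BddAbove (range fun c : Fin n → Iic M => b fun i => (c i).1) := by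
    rw [bddAbove_iff]
    exact mk_range_le.trans_lt (mk_pi_Iic_lt n M)
  obtain ⟨B, hB⟩ := this
  obtain ⟨_, ⟨y, rfl⟩, hy⟩ := hF B
  exact hy.not_ge ((hb _ y).trans
    (hB ⟨fun i => ⟨G y i, (hG y i).trans (hM ⟨i, rfl⟩)⟩, rfl⟩))

omit [RegularOrder X] in
theorem unbounded_mono {s t : Set X} (hs : Unbounded s) (h : s ⊆ t) : Unbounded t := fun a =>
  (hs a).imp fun _ hx => ⟨h hx.1, hx.2⟩

omit [RegularOrder X] in
theorem bddAbove_of_not {s : Set X} (h : ¬ Unbounded s) : BddAbove s :=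
  not_not.1 (mt not_bddAbove_iff_unbounded.1 h)

/-- As `g i` is not heavy, `g i a y` is bounded in `y` (`σ i = true`) or `g i x b` is bounded in `x`
(`σ i = false`). Bounded inputs can be frozen to constants without losing unboundedness, so `f`
remains heavy with the remaining inputs driven by `x` where `σ` is true and by `y` where it is
false. -/
theorem Heavy.exists_minor [Infinite X] {k : ℕ} {f : Op X k} {g : Fin (k + 1) → X → X → X}
    (hg : ∀ i, ¬ Heavy (g i)) (hf : Heavy fun x y => f fun i => g i x y) :
    ∃ p σ, Heavy (minor f p σ) := by
  classical
  obtain ⟨⟨b, hb⟩, a, ha⟩ := hf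
  let σ : Fin (k + 1) → Bool := fun i => decide (∀ a, ¬ Unbounded (range fun y => g i a y))
  have hσt : ∀ i, σ i = true → ∃ m, ∀ y, g i a y ≤ m := fun i hi => by
    obtain ⟨m, hm⟩ := bddAbove_of_not (of_decide_eq_true hi a)
    exact ⟨m, fun y => hm ⟨y, rfl⟩⟩
  have hσf : ∀ i, σ i = false → ∃ m, ∀ x, g i x b ≤ m := fun i hi => by
    have h1 := of_decide_eq_false hi
    push Not at h1
    obtain ⟨m, hm⟩ := bddAbove_of_not fun h => hg i ⟨⟨b, h⟩, h1⟩
    exact ⟨m, fun y => hm ⟨y, rfl⟩⟩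
  obtain ⟨c, hc⟩ : ∃ c : Fin (k + 1) → X,
      Unbounded (range fun y => f fun i => bif σ i then c i else g i a y) := by
    choose! m hm using hσt
    refine exists_unbounded_of_params (fun c y => f fun i => bif σ i then c i else g i a y)
      (fun y i => bif σ i then g i a y else a) (fun i => bif σ i then m i else a)
      (fun y i => ?_) (unbounded_mono ha (subset_of_eq ?_))
    · cases h : σ i
      · exact le_rfl
      · exact hm i h y
    · congr! 4 with y i
      cases σ i <;> rfl
  obtain ⟨d, hd⟩ : ∃ d : Fin (k + 1) → X,
      Unbounded (range fun x => f fun i => bif σ i then g i x b else d i) := by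
    choose! m hm using hσf
    refine exists_unbounded_of_params (fun d x => f fun i => bif σ i then g i x b else d i)
      (fun x i => bif σ i then b else g i x b) (fun i => bif σ i then b else m i)
      (fun x i => ?_) (unbounded_mono hb (subset_of_eq ?_))
    · cases h : σ i
      · exact hm i h x
      · exact le_rfl
    · congr! 4 with y i
      cases σ i <;> rfl
  -- The extra point `none` is where the frozen constants are stored.
  obtain ⟨ρ⟩ : Nonempty (X ≃ Option X) := Cardinal.eq.1 (by simp)
  let p : Fin (k + 1) → X → X := fun i t =>
    (ρ t).elim (bif σ i then c i else d i) fun x => bif σ i then g i x b else g i a x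
  refine ⟨p, σ, ⟨ρ.symm none, unbounded_mono hd ?_⟩, ρ.symm none, unbounded_mono hc ?_⟩
  · rintro _ ⟨x, rfl⟩
    refine ⟨ρ.symm (some x), congrArg f (funext fun i => ?_)⟩
    cases h : σ i <;> simp [p, h]
  · rintro _ ⟨x, rfl⟩
    refine ⟨ρ.symm (some x), congrArg f (funext fun i => ?_)⟩
    cases h : σ i <;> simp [p, h]

omit [RegularOrder X] in
theorem not_unbounded_singleton (s : Set X) (c : X) (h : ∀ x ∈ s, x = c) : ¬ Unbounded s :=
  fun hs => by
    obtain ⟨x, hx, hlt⟩ := hs c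
    exact hlt.ne' (h x hx)

/-- Thin out for one `g i` after another by the canonical Ramsey theorem. The injective case would
make `g i` wild, so each `g i` becomes unary on increasing pairs. There the composite equals a minor
of `f`, and wildness looks at increasing pairs only. -/
theorem Wild.exists_minor [Infinite X] (hcoh : Cohesive X) {k : ℕ} {f : Op X k}
    {g : Fin (k + 1) → X → X → X} (hg : ∀ i, ¬ Wild (g i))
    (hf : Wild fun x y => f fun i => g i x y) : ∃ p σ, Wild (minor f p σ) := by
  classical
  obtain ⟨u, v, hf⟩ := hf
  obtain ⟨e, he, hun⟩ : ∃ e : X → X, StrictMono e ∧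
      ∀ i ∈ (Finset.univ : Finset (Fin (k + 1))),
        UnaryOnIncreasing fun x y => g i (u (e x)) (v (e y)) := by
    induction (Finset.univ : Finset (Fin (k + 1))) using Finset.induction_on with
    | empty => exact ⟨id, strictMono_id, by simp⟩
    | insert i s _ ih =>
      obtain ⟨e, he, h⟩ := ih
      obtain ⟨e', he', h' | h'⟩ := hcoh.canonical fun x y => g i (u (e x)) (v (e y))
      · refine ⟨e ∘ e', he.comp he', fun j hj => ?_⟩
        rcases Finset.mem_insert.1 hj with rfl | hj
        · exact h'
        · exact (h j hj).comp he'
      · exact absurd ⟨_, _, h'⟩ (hg i)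
  have : ∀ i, ∃ (p : X → X) (σ : Bool), ∀ x y, x < y →
      g i (u (e x)) (v (e y)) = p (bif σ then x else y) := fun i => by
    rcases hun i (Finset.mem_univ i) with ⟨p, hp⟩ | ⟨p, hp⟩
    · exact ⟨p, true, hp⟩
    · exact ⟨p, false, hp⟩
  choose p σ hp using this
  refine ⟨p, σ, id, id, fun x y z w hxy hzw h => hf.comp he x y z w hxy hzw ?_⟩
  simp only [hp _ _ _ hxy, hp _ _ _ hzw]
  exact h

omit [RegularOrder X] in
theorem not_heavy_fst (p : X → X) : ¬ Heavy fun x _ : X => p x := fun ⟨_, a, ha⟩ =>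
  not_unbounded_singleton _ (p a) (by rintro _ ⟨_, rfl⟩; rfl) ha

omit [RegularOrder X] in
theorem not_heavy_snd (p : X → X) : ¬ Heavy fun _ y : X => p y := fun ⟨⟨a, ha⟩, _⟩ =>
  not_unbounded_singleton _ (p a) (by rintro _ ⟨_, rfl⟩; rfl) ha

theorem RegularOrder.exists_seq_nat [Nonempty X] : ∃ s : ℕ → X, StrictMono s := by
  choose s hs using exists_gt' (X := X)
  exact ⟨fun n => s^[n] (Classical.arbitrary X),
    strictMono_nat_of_lt_succ fun n => by rw [Function.iterate_succ_apply']; exact hs _⟩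

theorem not_wild_fst [Nonempty X] (p : X → X) : ¬ Wild fun x _ : X => p x := by
  rintro ⟨u, v, h⟩
  obtain ⟨s, hs⟩ := exists_seq_nat (X := X)
  have := (h (s 0) (s 1) (s 0) (s 2) (hs (by norm_num)) (hs (by norm_num)) rfl).2
  exact absurd (hs.injective this) (by norm_num)

theorem not_wild_snd [Nonempty X] (p : X → X) : ¬ Wild fun _ y : X => p y := by
  rintro ⟨u, v, h⟩
  obtain ⟨s, hs⟩ := exists_seq_nat (X := X)
  have := (h (s 0) (s 2) (s 1) (s 2) (hs (by norm_num)) (hs (by norm_num)) rfl).1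
  exact absurd (hs.injective this) (by norm_num)

theorem heavy_wedge (z : X) : Heavy (wedge z) := by
  refine ⟨⟨z, unbounded_mono unbounded_univ fun x _ => ⟨x, ?_⟩⟩, z, unbounded_mono unbounded_univ fun x _ => ⟨x, ?_⟩⟩
  · simp only [wedge]
    grind
  · simp [wedge]

/-- A column with `q y ≠ z` takes at most the two values `q y` and `z`, so three points below it
force `q y = z`. Two such columns then coincide. -/
theorem not_injOnIncreasing_wedge [Nonempty X] (z : X) (p q : X → X) :
    ¬ InjOnIncreasing fun x y => wedge z (p x) (q y) := by
  intro h
  obtain ⟨s, hs⟩ := exists_seq_nat (X := X)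
  have key : ∀ i j k l : ℕ, i < j → k < l →
      wedge z (p (s i)) (q (s j)) = wedge z (p (s k)) (q (s l)) → i = k ∧ j = l :=
    fun i j k l hij hkl he => (h _ _ _ _ (hs hij) (hs hkl) he).imp (fun h => hs.injective h)
      fun h => hs.injective h
  have h1 := key 0 3 0 4
  have h2 := key 0 3 1 3
  have h3 := key 0 3 2 3
  have h4 := key 1 3 2 3
  have h5 := key 0 4 1 4
  have h6 := key 0 4 2 4
  have h7 := key 1 4 2 4
  simp only [wedge] at h1 h2 h3 h4 h5 h6 h7
  grind

theorem exists_pairing (X : Type u) [Infinite X] : ∃ φ : Option (X × X) → X, φ.Injective := by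
  obtain ⟨φ⟩ : Nonempty (Option (X × X) ≃ X) := Cardinal.eq.1 (by simp)
  exact ⟨φ, φ.injective⟩

/-- The pairs `x ≤ y` are coded injectively and all the others by one further value. -/
def upperCode (φ : Option (X × X) → X) (x y : X) : X := φ (if x ≤ y then some (x, y) else none)

omit [RegularOrder X] in
theorem separating_upperCode {φ : Option (X × X) → X} (hφ : φ.Injective) :
    Separating (upperCode φ) := by
  constructor
  · intro x y z w hxy hzw h
    simpa [hxy, hzw] using hφ h
  · intro x y z w hxy hwz h
    simpa [hxy, hwz.not_ge] using hφ h

/-- Column `b` contains only the codes of pairs with first entry at most `b`, and the one value `φ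
none`. -/
theorem not_unbounded_upperCode (φ : Option (X × X) → X) (b : X) (p : X → X) :
    ¬ Unbounded (range fun x => upperCode φ (p x) b) := by
  obtain ⟨M, hM⟩ := exists_bound (fun x => upperCode φ x b) b
  intro h
  obtain ⟨_, ⟨x, rfl⟩, hx⟩ := h (max M (φ none))
  have hx := max_lt_iff.1 hx
  by_cases hxb : p x ≤ b
  · exact hx.1.not_ge (hM _ hxb)
  · simp [upperCode, hxb] at hx

theorem unbounded_range_of_injective {f : X → X} (hf : f.Injective) : Unbounded (range f) :=
  mk_eq_iff_unbounded.1 (mk_range_eq f hf)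

theorem heavy_of_injective [Nonempty X] {h : X → X → X}
    (hinj : ∀ x y z w, h x y = h z w → x = z ∧ y = w) : Heavy h :=
  have a := Classical.arbitrary X
  ⟨⟨a, unbounded_range_of_injective fun _ _ h => (hinj _ _ _ _ h).1⟩,
    a, unbounded_range_of_injective fun _ _ h => (hinj _ _ _ _ h).2⟩

omit [RegularOrder X] in
theorem wild_of_injective {h : X → X → X}
    (hinj : ∀ x y z w, h x y = h z w → x = z ∧ y = w) : Wild h :=
  ⟨id, id, fun x y z w _ _ h => hinj x y z w h⟩

/-- The clone of the functions without minors depending heavily on both arguments. -/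
def lightClone (X : Type u) [LinearOrder X] [RegularOrder X] [Infinite X] : Clone X :=
  .minorFree Heavy not_heavy_fst not_heavy_snd fun _ _ _ => Heavy.exists_minor

/-- The clone of the functions without wild minors. -/
def tameClone [Infinite X] (hcoh : Cohesive X) : Clone X :=
  .minorFree Wild not_wild_fst not_wild_snd fun _ _ _ => Wild.exists_minor hcoh

theorem lightClone_precomplete [Infinite X] : (lightClone X).Precomplete := by
  obtain ⟨φ, hφ⟩ := exists_pairing X
  refine Clone.minorFree_precomplete ⟨fun x y => φ (some (x, y)), heavy_of_injective
    fun x y z w h => by simpa using hφ h⟩ fun C hC ⟨h, hh, hheavy⟩ => ?_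
  refine (Clone.minorFree_containsAllUnary.mono hC).eq_top_of_separating hh hheavy
    (hC 1 (Clone.mem₂_minorFree ?_ ?_)) (separating_upperCode hφ)
  · exact fun p q ⟨⟨b, hb⟩, _⟩ => not_unbounded_upperCode φ (q b) p hb
  · exact fun p q ⟨_, a, ha⟩ => not_unbounded_upperCode φ (q a) p ha

theorem tameClone_heavilyBinary [Infinite X] (hcoh : Cohesive X) :
    (tameClone hcoh).HeavilyBinary := by
  refine heavilyBinary_iff.2 ⟨_, Clone.mem₂_minorFree ?_ ?_, heavy_wedge (Classical.arbitrary X)⟩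
  · exact fun p q ⟨u, v, h⟩ => not_injOnIncreasing_wedge _ (p ∘ u) (q ∘ v) h
  · rintro p q ⟨u, v, h⟩
    refine not_injOnIncreasing_wedge (Classical.arbitrary X) (q ∘ u) (p ∘ v) ?_
    exact fun x y z w hxy hzw he =>
      h x y z w hxy hzw ((wedge_comm _ _ _).trans (he.trans (wedge_comm _ _ _)))

theorem tameClone_precomplete [Infinite X] (hcoh : Cohesive X) :
    (tameClone hcoh).Precomplete := by
  obtain ⟨φ, hφ⟩ := exists_pairing X
  refine Clone.minorFree_precomplete ⟨fun x y => φ (some (x, y)), wild_of_injective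
    fun x y z w h => by simpa using hφ h⟩ fun C hC ⟨g, hg, hw⟩ => ?_
  obtain ⟨h, hh, hheavy⟩ := heavilyBinary_iff.1 (tameClone_heavilyBinary hcoh)
  exact (Clone.minorFree_containsAllUnary.mono hC).eq_top_of_wild hcoh (hC 1 hh) hheavy hg hw

theorem eq_tameClone [Infinite X] (hcoh : Cohesive X) {C : Clone X} (hC : C.Precomplete)
    (hU : C.ContainsAllUnary) (hH : C.HeavilyBinary) : C = tameClone hcoh := by
  obtain ⟨h, hh, hheavy⟩ := heavilyBinary_iff.1 hH
  exact hC.eq_minorFree (tameClone_precomplete hcoh) hU fun g hg hw =>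
    hC.1 (hU.eq_top_of_wild hcoh hh hheavy hg hw)

theorem eq_lightClone [Infinite X] {C : Clone X} (hC : C.Precomplete)
    (hU : C.ContainsAllUnary) (hH : ¬ C.HeavilyBinary) : C = lightClone X :=
  hC.eq_minorFree lightClone_precomplete hU fun g hg hw => hH (heavilyBinary_iff.2 ⟨g, hg, hw⟩)

theorem lightClone_not_heavilyBinary [Infinite X] : ¬ (lightClone X).HeavilyBinary := fun h => by
  obtain ⟨h, hh, hheavy⟩ := heavilyBinary_iff.1 h
  exact Clone.not_of_mem₂_minorFree hh hheavy

end Order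

/-! ### Suitable well-orders, and the theorem. -/

section Existence

theorem exists_order_of_countable {X : Type u} (hX : #X = ℵ₀) : ∃ _ : LinearOrder X,
    WellFoundedLT X ∧ (∀ a : X, #(Iic a) < #X) ∧ TransRamsey X := by
  obtain ⟨φ⟩ : Nonempty (X ≃ ℕ) := by
    rw [← lift_mk_eq'.{u, 0}]
    simp [hX]
  let _ : LinearOrder X := LinearOrder.lift' φ φ.injective
  have hlt : ∀ x y : X, x < y ↔ φ x < φ y := fun _ _ => Iff.rfl
  refine ⟨inferInstance, ⟨InvImage.wf φ wellFounded_lt⟩, fun a => ?_, fun r hr => ?_⟩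
  · rw [hX, lt_aleph0_iff_set_finite]
    exact (finite_Iic (φ a)).preimage φ.injective.injOn
  · have : IsTrans X r := ⟨hr⟩
    obtain ⟨g, hg⟩ := exists_increasing_or_nonincreasing_subseq r φ.symm
    refine ⟨range (φ.symm ∘ g), ?_, ?_⟩
    · have : Infinite (range (φ.symm ∘ g)) :=
        (infinite_range_of_injective (φ.symm.injective.comp g.injective)).to_subtype
      have : Countable X := φ.injective.countable
      rw [hX, mk_eq_aleph0]
    · have key : ∀ m n, φ.symm (g m) < φ.symm (g n) → m < n := fun m n h => by
        simpa [hlt] using h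
      refine hg.imp ?_ ?_
      · rintro h _ ⟨m, rfl⟩ _ ⟨n, rfl⟩ hmn
        exact h m n (key m n hmn)
      · rintro h _ ⟨m, rfl⟩ _ ⟨n, rfl⟩ hmn
        exact h m n (key m n hmn)

theorem exists_order_of_partitionArrow {X : Type u} (hX : ℵ₀ ≤ #X)
    (hP : PartitionArrow #X #X 2 2) : ∃ _ : LinearOrder X,
    WellFoundedLT X ∧ (∀ a : X, #(Iic a) < #X) ∧ TransRamsey X := by
  classical
  obtain ⟨r, wo, hr⟩ := exists_ord_eq X
  let _ : LinearOrder X := linearOrderOfSTO r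
  have wf : WellFoundedLT X := ⟨wo.wf⟩
  refine ⟨inferInstance, wf, fun a => ?_, fun q _ => ?_⟩
  · have h : #(Iio a) < #X := mk_Iio_lt a hr
    rw [← Iio_insert]
    refine (mk_insert_le).trans_lt (add_lt_of_lt hX h (one_lt_aleph0.trans_le hX))
  -- A two-element set is coloured by whether `q` holds between its elements in increasing order.
  · obtain ⟨S, hS, hom⟩ := hP X rfl fun s =>
      if ∃ x y, x < y ∧ s.1 = {x, y} ∧ q x y then 0 else 1
    refine ⟨S, le_antisymm (mk_set_le S) hS, ?_⟩
    have key : ∀ x y (h : x < y), (∃ z w, z < w ∧ ({x, y} : Finset X) = {z, w} ∧ q z w) ↔ q x y := by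
      refine fun x y h => ⟨?_, fun hq => ⟨x, y, h, rfl, hq⟩⟩
      rintro ⟨z, w, hzw, he, hq⟩
      have h1 : x ∈ ({z, w} : Finset X) := he ▸ by simp
      have h2 : y ∈ ({z, w} : Finset X) := he ▸ by simp
      simp only [Finset.mem_insert, Finset.mem_singleton] at h1 h2
      rcases h1 with rfl | rfl <;> rcases h2 with rfl | rfl
      · exact absurd h (lt_irrefl _)
      · exact hq
      · exact absurd h (lt_asymm hzw)
      · exact absurd h (lt_irrefl _)
    have hom' : ∀ x ∈ S, ∀ y ∈ S, ∀ z ∈ S, ∀ w ∈ S, x < y → z < w → q x y → q z w := by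
      intro x hx y hy z hz w hw hxy hzw hq
      by_contra hq'
      have := hom ⟨{x, y}, Finset.card_pair hxy.ne⟩ ⟨{z, w}, Finset.card_pair hzw.ne⟩
        (by simp [insert_subset_iff, hx, hy]) (by simp [insert_subset_iff, hz, hw])
      simp only [key x y hxy, key z w hzw, hq, hq', if_true, if_false] at this
      exact absurd this (by decide)
    by_cases h : ∃ x ∈ S, ∃ y ∈ S, x < y ∧ q x y
    · obtain ⟨x, hx, y, hy, hxy, hq⟩ := h
      exact .inl fun z hz w hw hzw => hom' x hx y hy z hz w hw hxy hzw hq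
    · exact .inr fun z hz w hw hzw hq => h ⟨z, hz, w, hw, hzw, hq⟩

end Existence

theorem mainTheorem4 (X : Type u)
    (hX : Cardinal.mk X = Cardinal.aleph0 ∨ IsWeaklyCompactCardinal (Cardinal.mk X)) :
    (∃! C : Clone X, C.Precomplete ∧ C.ContainsAllUnary ∧ C.HeavilyBinary) ∧
      {C : Clone X | C.Precomplete ∧ Clone.fullUnary X ≤ C}.encard = 2 := by
  have : Infinite X := infinite_iff.2 (hX.elim (fun h => h.ge) fun h => h.1.le)
  obtain ⟨_, wf, hs, hR⟩ := hX.elim exists_order_of_countable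
    fun h => exists_order_of_partitionArrow h.1.le h.2
  have := regularOrder_of_transRamsey hs hR
  have hcoh := cohesive_of_transRamsey hR
  have htame := tameClone_heavilyBinary hcoh
  refine ⟨⟨tameClone hcoh, ⟨tameClone_precomplete hcoh, Clone.minorFree_containsAllUnary, htame⟩,
    fun C hC => eq_tameClone hcoh hC.1 hC.2.1 hC.2.2⟩, ?_⟩
  have hne : tameClone hcoh ≠ lightClone X := fun h => lightClone_not_heavilyBinary (h ▸ htame)
  rw [← encard_pair hne]
  congr 1
  ext C
  simp only [mem_ofPred_eq, Clone.fullUnary_le_iff, mem_insert_iff, mem_singleton_iff]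
  constructor
  · rintro ⟨hC, hU⟩
    by_cases hH : C.HeavilyBinary
    · exact .inl (eq_tameClone hcoh hC hU hH)
    · exact .inr (eq_lightClone hC hU hH)
  · rintro (rfl | rfl)
    · exact ⟨tameClone_precomplete hcoh, Clone.minorFree_containsAllUnary⟩
    · exact ⟨lightClone_precomplete, Clone.minorFree_containsAllUnary⟩
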